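/- For $a>0$ consider the scalar system with two controllers $$x[n+1]=a\,x[n]+u_1[n]+u_2[n]+w[n],\qquad y_1[n]=x[n]+v_1[n],\qquad y_2[n]=x[n]+v_2[n]\qquad(n\ge 0),$$ where $x[0]\sim\mathcal N(0,\sigma_0^2)$, $w[n]\sim\mathcal N(0,1)$, $v_1[n]\sim\mathcal N(0,\sigma_{v1}^2)$, $v_2[n]\sim\mathcal N(0,\sigma_{v2}^2)$ are all independent and $u_i[n]$ is a function of $y_i[0],\dots,y_i[n]$. The cost of a pair of strategies is $$J_a(u_1,u_2)=\limsup_{N\to\infty}\frac1N\sum_{0\le n<N}\Big(q\,\mathbb E[x^2[n]]+r_1\,\mathbb E[u_1^2[n]]+r_2\,\mathbb E[u_2^2[n]]\Big)\in[0,\infty].$$ Take $q=1$, $r_1=a$, $r_2=0$, $\sigma_0=0$, $\sigma_{v1}=0$, $\sigma_{v2}^2=a$. Let $L'_{lin}$ be the set of all linear time-varying controllers, $u_1[n]=\sum_{i\le n}k_{n,i}\,y_1[i]$, $u_2[n]=\sum_{i\le n}k'_{n,i}\,y_2[i]$ with real $k_{n,i},k'_{n,i}$. Let $L_{sig,1}$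 be the set of 1-stage signaling strategies, i.e. those of the form, for some $d>0$, $$u_1[n]=-a\,R_d(y_1[n]),\qquad u_2[n]=-a\Big(Q_{ad}\big(y_2[n]-R_{ad}(u_2[n-1])\big)+R_{ad}(u_2[n-1])\Big),$$ where $Q_x(y)=x\lfloor y/x+\tfrac12\rfloor$, $R_x(y)=y-Q_x(y)$ and $u_2[-1]=0$. Then, for all sufficiently large $a$, $\inf_{L'_{lin}}J_a$ is finite and $\inf_{L_{sig,1}}J_a$ is finite and positive, and $$\frac{\inf_{(u_1,u_2)\in L'_{lin}}J_a(u_1,u_2)}{\inf_{(u_1,u_2)\in L_{sig,1}}J_a(u_1,u_2)}\longrightarrow\infty\qquad\text{as } a\to\infty .$$ Moreover, as $a\to\infty$, $\inf_{L'_{lin}}J_a=\Omega(a^3)$ and $\inf_{L_{sig,1}}J_a=O(a^2\log a)$. -/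

import Mathlib

open MeasureTheory ProbabilityTheory Filter Topology
open scoped ENNReal NNReal

namespace DecLQG

/-- Parameters of the scalar decentralized LQG problem with two controllers:
the gain `a`, the cost weights `q`, `r1`, `r2`, and the variances of the initial state `x[0]` and
of the observation noises `v1[n]`, `v2[n]`. The process noise has variance `1`. -/
structure Params where
  a : ℝ
  q : ℝ≥0
  r1 : ℝ≥0
  r2 : ℝ≥0
  varX0 : ℝ≥0
  varV1 : ℝ≥0
  varV2 : ℝ≥0

/-- Labels of the underlying random variables. -/
inductive Noise where
  | x0 : Noise
  | w : ℕ → Noise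
  | v1 : ℕ → Noise
  | v2 : ℕ → Noise

/-- The variance of each of the underlying random variables. -/
def Params.var (P : Params) : Noise → ℝ≥0
  | .x0 => P.varX0
  | .w _ => 1
  | .v1 _ => P.varV1
  | .v2 _ => P.varV2

/-- The underlying random variables are independent centred Gaussians: the probability space is
`Noise → ℝ` with the product of the Gaussian laws, and the random variables are the coordinates.
(A Gaussian law of variance `0` is the point mass at `0`.) -/
noncomputable def Params.law (P : Params) : Measure (Noise → ℝ) :=
  Measure.infinitePi fun i => gaussianReal 0 (P.var i)

/-- A causal control strategy: the input at time `n` is a function of the observations at the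
times `0, …, n`. -/
abbrev Strategy : Type := (n : ℕ) → (Fin (n + 1) → ℝ) → ℝ

/-- The input that a strategy produces at time `n` on the observation sequence `y`. -/
def Strategy.input (g : Strategy) (y : ℕ → ℝ) (n : ℕ) : ℝ :=
  g n fun i => y i

/-- The state of the closed loop:
`x[n+1] = a x[n] + u1[n] + u2[n] + w[n]`, where `u1[n]` and `u2[n]` are computed from the
observations `y1[i] = x[i] + v1[i]` and `y2[i] = x[i] + v2[i]`, `i ≤ n`, respectively. -/
noncomputable def state (P : Params) (g : Strategy × Strategy) (ω : Noise → ℝ) : ℕ → ℝ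
  | 0 => ω .x0
  | n + 1 =>
      P.a * state P g ω n
        + g.1 n (fun i : Fin (n + 1) => state P g ω i + ω (.v1 i))
        + g.2 n (fun i : Fin (n + 1) => state P g ω i + ω (.v2 i))
        + ω (.w n)
decreasing_by
  all_goals omega

/-- The observation of the first controller at time `n`. -/
noncomputable def obs1 (P : Params) (g : Strategy × Strategy) (ω : Noise → ℝ) (n : ℕ) : ℝ :=
  state P g ω n + ω (.v1 n)

/-- The observation of the second controller at time `n`. -/
noncomputable def obs2 (P : Params) (g : Strategy × Strategy) (ω : Noise → ℝ) (n : ℕ) : ℝ :=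
  state P g ω n + ω (.v2 n)

/-- The input `u1[n]` in the closed loop. -/
noncomputable def input1 (P : Params) (g : Strategy × Strategy) (ω : Noise → ℝ) (n : ℕ) : ℝ :=
  g.1.input (obs1 P g ω) n

/-- The input `u2[n]` in the closed loop. -/
noncomputable def input2 (P : Params) (g : Strategy × Strategy) (ω : Noise → ℝ) (n : ℕ) : ℝ :=
  g.2.input (obs2 P g ω) n

/-- The second moment `E[X ^ 2]`, with the value `∞` if it is not finite. -/
noncomputable def secondMoment (P : Params) (X : (Noise → ℝ) → ℝ) : ℝ≥0∞ :=
  ∫⁻ ω, ENNReal.ofReal (X ω ^ 2) ∂P.law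

/-- The long-term average cost
`limsup_N (1/N) ∑_{0 ≤ n < N} (q E[x[n]^2] + r1 E[u1[n]^2] + r2 E[u2[n]^2])`. -/
noncomputable def avgCost (P : Params) (g : Strategy × Strategy) : ℝ≥0∞ :=
  limsup (fun N : ℕ => (N : ℝ≥0∞)⁻¹ * ∑ n ∈ Finset.range N,
    (P.q * secondMoment P (fun ω => state P g ω n)
      + P.r1 * secondMoment P (fun ω => input1 P g ω n)
      + P.r2 * secondMoment P (fun ω => input2 P g ω n))) atTop

/-- The best average cost over a set of pairs of strategies. -/
noncomputable def bestCost (P : Params) (L : Set (Strategy × Strategy)) : ℝ≥0∞ :=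
  ⨅ g ∈ L, avgCost P g

/-- All pairs of linear time-varying strategies:
`u1[n] = ∑_{i ≤ n} k n i * y1[i]` and `u2[n] = ∑_{i ≤ n} k' n i * y2[i]`. -/
def linearStrategies : Set (Strategy × Strategy) :=
  {g | ∃ k k' : ℕ → ℕ → ℝ, ∀ (y : ℕ → ℝ) (n : ℕ),
    g.1.input y n = ∑ i ∈ Finset.range (n + 1), k n i * y i ∧
    g.2.input y n = ∑ i ∈ Finset.range (n + 1), k' n i * y i}

/-- The quantizer `Q_x(y) = x ⌊y / x + 1 / 2⌋`. -/
noncomputable def quant (x y : ℝ) : ℝ := x * (⌊y / x + 1 / 2⌋ : ℤ)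

/-- The remainder `R_x(y) = y - Q_x(y)`. -/
noncomputable def rmdr (x y : ℝ) : ℝ := y - quant x y

/-- `∑_{1 ≤ i ≤ s} a^(i-1) u[n-i]`, with `u[m] = 0` for `m < 0`. -/
noncomputable def pastSum (a : ℝ) (s : ℕ) (u : ℕ → ℝ) (n : ℕ) : ℝ :=
  ∑ i ∈ Finset.Icc 1 s, a ^ (i - 1) * (if i ≤ n then u (n - i) else 0)

/-- The `s`-stage signaling strategies for the gain `a`: for some `d > 0`,
`u1[n] = -a R_d(y1[n])` and
`u2[n] = -a (Q_{a^s d}(y2[n] - c[n]) + c[n])`, where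
`c[n] = R_{a^s d}(∑_{1 ≤ i ≤ s} a^(i-1) u2[n-i])`. -/
def signalingStrategies (a : ℝ) (s : ℕ) : Set (Strategy × Strategy) :=
  {g | ∃ d : ℝ, 0 < d ∧ ∀ (y : ℕ → ℝ) (n : ℕ),
    g.1.input y n = -a * rmdr d (y n) ∧
    g.2.input y n =
      -a * (quant (a ^ s * d) (y n - rmdr (a ^ s * d) (pastSum a s (g.2.input y) n))
        + rmdr (a ^ s * d) (pastSum a s (g.2.input y) n))}

/-- The parameters `q = 1`, `r1 = a`, `r2 = 0`, `σ_0 = 0`, `σ_{v1} = 0`, `σ_{v2}^2 = a`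
(meaningful for `a ≥ 0`). -/
noncomputable def params (a : ℝ) : Params where
  a := a
  q := 1
  r1 := a.toNNReal
  r2 := 0
  varX0 := 0
  varV1 := 0
  varV2 := a.toNNReal

/-- The best cost over all linear time-varying strategies. -/
noncomputable def linCost (a : ℝ) : ℝ≥0∞ :=
  bestCost (params a) linearStrategies

/-- The best cost over all 1-stage signaling strategies. -/
noncomputable def sigCost (a : ℝ) : ℝ≥0∞ :=
  bestCost (params a) (signalingStrategies a 1)

end DecLQG

/-!
Lower bound for linear strategies. By linearity every variable of the closed loop is a combination
of the independent noises, so a second moment is at least the part contributed by any chosen finite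
set of noises (`sum_le_secondMoment`). Take the process noise `w[n]`, which enters `x[n+1]`, and the
observation noises `v2[n+1]`, `v2[n+2]` through which the second controller sees it twice. If the
first controller spends much less than `a ^ 2` on average on `u1[n+1]` and `u1[n+2]`, it cannot
change the coefficient of `w[n]` in `x[n+2]` or `x[n+3]` to leading order: left alone these would
be `a` and `a ^ 2`. The second controller can cancel the coefficient `a ^ 2` only by using its
observations of `x[n+1]` and `x[n+2]`, and this feeds in the observation noise of variance `a`, with
gain at least of order `a`. Either way three consecutive stages cost at least a multiple of `a ^ 3`
(`gain_tradeoff`, `le_stageCost_of_linear`).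

Upper bound for signaling. The first controller moves the state onto a lattice of step `d`, which
the dynamics expand to step `a d`; hence `x[n]` is known to the second controller modulo `a d`,
up to the fresh noise `w[n-1]`, and rounding its observation recovers `x[n] - w[n-1]` unless
`w[n-1] + v2[n]` exceeds `a d / 2`. The resulting recursion (`state_succ_of_signaling`) has no
memory, so errors do not accumulate. With `d ^ 2 = 324 log a / a` the rounding errors have bounded
second moment by the Gaussian moment generating function, the state contributes a multiple of
`a ^ 2`, and the first controller contributes at most `a * a ^ 2 * d ^ 2 / 4 = 81 a ^ 2 log a`
(`sigCost_le`). The process noise alone keeps the cost positive (`le_sigCost`).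
-/

namespace DecLQG

/-! ### Moments of the noise -/

open Classical in
/-- The noise with the sign of the coordinate `i` reversed. -/
noncomputable def signFlip (i : Noise) (ω : Noise → ℝ) : Noise → ℝ :=
  fun j => if j = i then -ω j else ω j

open Classical in
/-- The noise with the coordinates in `s` set to `0`. -/
noncomputable def mask (s : Finset Noise) (ω : Noise → ℝ) : Noise → ℝ :=
  fun j => if j ∈ s then 0 else ω j

instance (P : Params) : IsProbabilityMeasure P.law := by
  unfold Params.law; infer_instance

lemma measurable_signFlip (i : Noise) : Measurable (signFlip i) := by
  refine measurable_pi_lambda _ fun j => ?_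
  by_cases h : j = i <;> simp only [signFlip, h, if_true, if_false] <;> fun_prop

lemma measurable_mask (s : Finset Noise) : Measurable (mask s) := by
  refine measurable_pi_lambda _ fun j => ?_
  by_cases h : j ∈ s <;> simp only [mask, h, if_true, if_false] <;> fun_prop

lemma mask_signFlip {s : Finset Noise} {i : Noise} (hi : i ∈ s) (ω : Noise → ℝ) :
    mask s (signFlip i ω) = mask s ω := by
  funext j
  by_cases h : j ∈ s
  · simp [mask, h]
  · have : j ≠ i := fun e => h (e ▸ hi)
    simp [mask, signFlip, h, this]

lemma measurePreserving_signFlip (P : Params) (i : Noise) :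
    MeasurePreserving (signFlip i) P.law P.law := by
  classical
  refine ⟨measurable_signFlip i, ?_⟩
  have h := Measure.infinitePi_map_pi (μ := fun j => gaussianReal 0 (P.var j))
    (f := fun j x => if j = i then -x else x)
    (fun j => by by_cases h : j = i <;> simp only [h, if_true, if_false] <;> fun_prop)
  have hflip : signFlip i = fun (x : Noise → ℝ) j => if j = i then -x j else x j := by
    funext x j; simp [signFlip]
  rw [hflip, Params.law, h]
  congr 1
  funext j
  by_cases h : j = i
  · simp [h, gaussianReal_map_neg]
  · simp [h]

lemma lintegral_noise (P : Params) (i : Noise) {f : ℝ → ℝ≥0∞} (hf : Measurable f) :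
    ∫⁻ ω, f (ω i) ∂P.law = ∫⁻ x, f x ∂gaussianReal 0 (P.var i) :=
  (measurePreserving_eval_infinitePi (fun j => gaussianReal 0 (P.var j)) i).lintegral_comp hf

lemma secondMoment_noise (P : Params) (i : Noise) :
    secondMoment P (fun ω => ω i) = P.var i := by
  unfold secondMoment
  rw [lintegral_noise P i (f := fun x => ENNReal.ofReal (x ^ 2)) (by fun_prop)]
  have hv := variance_fun_id_gaussianReal (μ := 0) (v := P.var i)
  rw [variance_eq_integral (by fun_prop)] at hv
  simp only [integral_id_gaussianReal, sub_zero] at hv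
  rw [← ofReal_integral_eq_lintegral_ofReal _ (ae_of_all _ fun x => sq_nonneg x), hv]
  · simp
  · exact (memLp_id_gaussianReal 2).integrable_sq

/-- The Gaussian moment generating function, as a lower integral. -/
lemma lintegral_exp_noise (P : Params) (i : Noise) (t : ℝ) :
    ∫⁻ ω, ENNReal.ofReal (Real.exp (t * ω i)) ∂P.law
      = ENNReal.ofReal (Real.exp (P.var i * t ^ 2 / 2)) := by
  rw [lintegral_noise P i (f := fun x => ENNReal.ofReal (Real.exp (t * x))) (by fun_prop),
    ← ofReal_integral_eq_lintegral_ofReal (integrable_exp_mul_gaussianReal t)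
      (ae_of_all _ fun x => (Real.exp_pos _).le)]
  have := congrFun (mgf_fun_id_gaussianReal (μ := 0) (v := P.var i)) t
  simp only [mgf, zero_mul, zero_add] at this
  rw [this]

/-- A noise coordinate of variance `0` vanishes almost surely. -/
lemma ae_noise_eq_zero {P : Params} {i : Noise} (h : P.var i = 0) : ∀ᵐ ω ∂P.law, ω i = 0 := by
  have h0 := secondMoment_noise P i
  rw [h, ENNReal.coe_zero, secondMoment, lintegral_eq_zero_iff (by fun_prop)] at h0
  filter_upwards [h0] with ω hω
  have : ω i ^ 2 ≤ 0 := by simpa using hω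
  nlinarith [sq_nonneg (ω i)]

lemma secondMoment_congr_ae {P : Params} {X Y : (Noise → ℝ) → ℝ} (h : ∀ᵐ ω ∂P.law, X ω = Y ω) :
    secondMoment P X = secondMoment P Y :=
  lintegral_congr_ae (h.mono fun ω hω => by simp only [hω])

/-- Splitting off a noise coordinate on which the rest `Z` does not depend. The cross term is
removed by averaging over the sign of that coordinate, which leaves the law unchanged. -/
lemma secondMoment_mul_add {P : Params} (i : Noise) (c : ℝ) {Z : (Noise → ℝ) → ℝ}
    (hZ : Measurable Z) (hflip : ∀ ω, Z (signFlip i ω) = Z ω) :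
    secondMoment P (fun ω => c * ω i + Z ω)
      = ENNReal.ofReal (c ^ 2) * P.var i + secondMoment P Z := by
  have h1 : secondMoment P (fun ω => c * ω i + Z ω)
      = secondMoment P (fun ω => -(c * ω i) + Z ω) := by
    unfold secondMoment
    rw [← (measurePreserving_signFlip P i).lintegral_comp (by fun_prop)]
    simp [hflip, signFlip]
  have h2 : secondMoment P (fun ω => c * ω i + Z ω) + secondMoment P (fun ω => -(c * ω i) + Z ω)
      = 2 * (ENNReal.ofReal (c ^ 2) * P.var i + secondMoment P Z) := by
    rw [← secondMoment_noise P i]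
    unfold secondMoment
    rw [← lintegral_add_left (by fun_prop), ← lintegral_const_mul _ (by fun_prop),
      ← lintegral_add_left (by fun_prop), ← lintegral_const_mul _ (by fun_prop)]
    refine lintegral_congr fun ω => ?_
    rw [← ENNReal.ofReal_mul (sq_nonneg _), ← ENNReal.ofReal_add (by positivity) (by positivity),
      ← ENNReal.ofReal_add (by positivity) (by positivity), ← ENNReal.ofReal_ofNat 2,
      ← ENNReal.ofReal_mul (by norm_num)]
    congr 1
    ring
  rw [← h1, ← two_mul] at h2
  exact (ENNReal.mul_right_inj (by norm_num) (by norm_num)).1 h2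

lemma secondMoment_sum_add {P : Params} (s : Finset Noise) (c : Noise → ℝ)
    {Z : (Noise → ℝ) → ℝ} (hZ : Measurable Z) (hflip : ∀ i ∈ s, ∀ ω, Z (signFlip i ω) = Z ω) :
    secondMoment P (fun ω => ∑ i ∈ s, c i * ω i + Z ω)
      = ∑ i ∈ s, ENNReal.ofReal (c i ^ 2) * P.var i + secondMoment P Z := by
  classical
  induction s using Finset.induction_on with
  | empty => simp
  | insert i s hi ih =>
    have hflip' : ∀ ω, (fun ω => ∑ j ∈ s, c j * ω j + Z ω) (signFlip i ω)
        = (fun ω => ∑ j ∈ s, c j * ω j + Z ω) ω := by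
      intro ω
      simp only [hflip i (Finset.mem_insert_self _ _)]
      congr 1
      refine Finset.sum_congr rfl fun j hj => ?_
      have : j ≠ i := fun e => hi (e ▸ hj)
      simp [signFlip, this]
    have := secondMoment_mul_add (P := P) i (c i)
      (Z := fun ω => ∑ j ∈ s, c j * ω j + Z ω) (by fun_prop) hflip'
    rw [ih fun j hj => hflip j (Finset.mem_insert_of_mem hj)] at this
    simp only [Finset.sum_insert hi, add_assoc]
    exact this

/-- If, apart from a part that does not see the coordinates in `s`, the variable `X` is the
combination of these coordinates with coefficients `c`, then its second moment is at least that of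
the combination. -/
lemma sum_le_secondMoment {P : Params} (s : Finset Noise) (c : Noise → ℝ)
    {X : (Noise → ℝ) → ℝ} (hX : Measurable X)
    (h : ∀ ω, X ω = ∑ i ∈ s, c i * ω i + X (mask s ω)) :
    ∑ i ∈ s, ENNReal.ofReal (c i ^ 2) * P.var i ≤ secondMoment P X := by
  have := secondMoment_sum_add (P := P) s c (Z := fun ω => X (mask s ω))
    (hX.comp (measurable_mask s)) (fun i hi ω => by simp only [mask_signFlip hi])
  simp only [← h] at this
  rw [show (fun ω => X ω) = X from rfl] at this
  rw [this]
  exact le_self_add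

/-! ### Long-term averages -/

/-- The expected cost incurred at time `n`. -/
noncomputable def stageCost (P : Params) (g : Strategy × Strategy) (n : ℕ) : ℝ≥0∞ :=
  P.q * secondMoment P (fun ω => state P g ω n)
    + P.r1 * secondMoment P (fun ω => input1 P g ω n)
    + P.r2 * secondMoment P (fun ω => input2 P g ω n)

lemma avgCost_le {P : Params} {g : Strategy × Strategy} {B : ℝ≥0∞}
    (h : ∀ n, stageCost P g n ≤ B) : avgCost P g ≤ B := by
  have hle : ∀ N : ℕ, (N : ℝ≥0∞)⁻¹ * ∑ n ∈ Finset.range N, stageCost P g n ≤ B := by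
    intro N
    rcases Nat.eq_zero_or_pos N with rfl | hN
    · simp
    · calc (N : ℝ≥0∞)⁻¹ * ∑ n ∈ Finset.range N, stageCost P g n
          ≤ (N : ℝ≥0∞)⁻¹ * (N * B) := by
            gcongr
            simpa using Finset.sum_le_card_nsmul (Finset.range N) _ B fun n _ => h n
        _ = B := by
            rw [← mul_assoc, ENNReal.inv_mul_cancel (by exact_mod_cast hN.ne')
              (ENNReal.natCast_ne_top N), one_mul]
  exact limsup_le_of_le (by isBoundedDefault) (Eventually.of_forall hle)

/-- Three consecutive stages cost at least `M`, so the average cost is at least `M / 4`; the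
constant leaves room for the first stage, about which nothing is assumed. -/
lemma le_avgCost {P : Params} {g : Strategy × Strategy} {M : ℝ≥0∞}
    (h : ∀ n, M ≤ stageCost P g (n + 1) + stageCost P g (n + 2) + stageCost P g (n + 3)) :
    M / 4 ≤ avgCost P g := by
  have hsum : ∀ m : ℕ, m * M ≤ ∑ n ∈ Finset.range (3 * m + 1), stageCost P g n := by
    intro m
    induction m with
    | zero => simp
    | succ m ih =>
      rw [show 3 * (m + 1) + 1 = 3 * m + 1 + 1 + 1 + 1 by ring, Finset.sum_range_succ,
        Finset.sum_range_succ, Finset.sum_range_succ]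
      push_cast
      rw [add_mul, one_mul, add_assoc, add_assoc]
      refine add_le_add ih ?_
      rw [← add_assoc]
      exact h (3 * m)
  have hfreq : ∃ᶠ N : ℕ in atTop,
      M / 4 ≤ (N : ℝ≥0∞)⁻¹ * ∑ n ∈ Finset.range N, stageCost P g n := by
    rw [frequently_atTop]
    intro N
    refine ⟨3 * (N + 1) + 1, by omega, ?_⟩
    calc M / 4 ≤ ((3 * (N + 1) + 1 : ℕ) : ℝ≥0∞)⁻¹ * ((N + 1 : ℕ) * M) := by
          rw [← ENNReal.div_eq_inv_mul, ENNReal.le_div_iff_mul_le (.inl (by simp))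
              (.inl (ENNReal.natCast_ne_top _)),
            ENNReal.div_eq_inv_mul, mul_comm _ M, mul_comm _ M, mul_assoc]
          gcongr
          rw [← ENNReal.div_eq_inv_mul]
          refine ENNReal.div_le_of_le_mul ?_
          norm_cast
          omega
      _ ≤ _ := by gcongr; exact hsum (N + 1)
  exact le_limsup_of_frequently_le hfreq (by isBoundedDefault)

/-! ### Measurability and causality of the closed loop -/

lemma measurable_state (P : Params) {g : Strategy × Strategy} (h1 : ∀ n, Measurable (g.1 n))
    (h2 : ∀ n, Measurable (g.2 n)) (n : ℕ) : Measurable (fun ω => state P g ω n) := by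
  induction n using Nat.strong_induction_on with
  | _ n ih =>
    cases n with
    | zero => simp only [state]; fun_prop
    | succ n =>
      simp only [state]
      have hi : ∀ i : Fin (n + 1), Measurable fun ω => state P g ω i := fun i => ih i i.2
      have hn := ih n (by omega)
      have e1 := (h1 n).comp (measurable_pi_lambda
        (fun (ω : Noise → ℝ) (i : Fin (n + 1)) => state P g ω i + ω (.v1 i))
        fun i => (hi i).add (measurable_pi_apply _))
      have e2 := (h2 n).comp (measurable_pi_lambda
        (fun (ω : Noise → ℝ) (i : Fin (n + 1)) => state P g ω i + ω (.v2 i))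
        fun i => (hi i).add (measurable_pi_apply _))
      exact (((hn.const_mul _).add e1).add e2).add (measurable_pi_apply _)

lemma measurable_input1 (P : Params) {g : Strategy × Strategy} (h1 : ∀ n, Measurable (g.1 n))
    (h2 : ∀ n, Measurable (g.2 n)) (n : ℕ) : Measurable (fun ω => input1 P g ω n) :=
  (h1 n).comp (measurable_pi_lambda _ fun i =>
    (measurable_state P h1 h2 i).add (measurable_pi_apply _))

/-- The observations `y[0], …, y[n]`, extended by `0` to all times. -/
def extend (n : ℕ) (f : Fin (n + 1) → ℝ) (i : ℕ) : ℝ :=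
  if h : i < n + 1 then f ⟨i, h⟩ else 0

lemma measurable_extend (n : ℕ) : Measurable (extend n) := by
  refine measurable_pi_lambda _ fun i => ?_
  by_cases h : i < n + 1 <;> simp only [extend, h, dite_true, dite_false] <;> fun_prop

lemma input_extend (g : Strategy) (n : ℕ) (f : Fin (n + 1) → ℝ) :
    g.input (extend n f) n = g n f := by
  refine congrArg (g n) (funext fun i => ?_)
  simp [extend, i.is_le]

/-- The components of a strategy are measurable as soon as its inputs are measurable functions of
the whole observation sequence. -/
lemma measurable_of_input {g : Strategy} {n : ℕ} (h : Measurable fun y => g.input y n) :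
    Measurable (g n) := by
  have := h.comp (measurable_extend n)
  simpa only [Function.comp_def, input_extend] using this

lemma state_succ (P : Params) (g : Strategy × Strategy) (ω : Noise → ℝ) (n : ℕ) :
    state P g ω (n + 1)
      = P.a * state P g ω n + input1 P g ω n + input2 P g ω n + ω (.w n) := by
  rw [state]; rfl

/-- Causality: the state at time `n` depends only on the noise before time `n`. -/
lemma state_congr (P : Params) (g : Strategy × Strategy) {ω ω' : Noise → ℝ}
    (h0 : ω .x0 = ω' .x0) (n : ℕ)
    (h : ∀ m < n, ω (.w m) = ω' (.w m) ∧ ω (.v1 m) = ω' (.v1 m) ∧ ω (.v2 m) = ω' (.v2 m)) :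
    state P g ω n = state P g ω' n := by
  induction n using Nat.strong_induction_on with
  | _ n ih =>
    cases n with
    | zero => simpa only [state] using h0
    | succ n =>
      have hi : ∀ m < n + 1, state P g ω m = state P g ω' m :=
        fun m hm => ih m hm fun l hl => h l (hl.trans hm)
      have e1 : (fun i : Fin (n + 1) => state P g ω i + ω (.v1 i))
          = fun i : Fin (n + 1) => state P g ω' i + ω' (.v1 i) :=
        funext fun i => by rw [hi i i.2, (h i i.2).2.1]
      have e2 : (fun i : Fin (n + 1) => state P g ω i + ω (.v2 i))
          = fun i : Fin (n + 1) => state P g ω' i + ω' (.v2 i) :=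
        funext fun i => by rw [hi i i.2, (h i i.2).2.2]
      simp only [state]
      rw [e1, e2, hi n (by omega), (h n (by omega)).1]

/-- Whatever the strategies, the process noise alone gives the state a second moment of at least
`1` at all positive times. -/
lemma one_le_secondMoment_state (P : Params) {g : Strategy × Strategy}
    (h1 : ∀ n, Measurable (g.1 n)) (h2 : ∀ n, Measurable (g.2 n)) (n : ℕ) :
    1 ≤ secondMoment P (fun ω => state P g ω (n + 1)) := by
  have h := sum_le_secondMoment (P := P) {Noise.w n} (fun _ => 1)
    (measurable_state P h1 h2 (n + 1)) fun ω => by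
      have hs : ∀ m < n + 1, state P g (mask {.w n} ω) m = state P g ω m := by
        intro m hm
        refine state_congr P g (by simp [mask]) m fun l hl => ?_
        have : l ≠ n := by omega
        simp [mask, this]
      have e1 : input1 P g (mask {.w n} ω) n = input1 P g ω n := by
        refine congrArg (g.1 n) (funext fun i => ?_)
        simp only [obs1, hs i i.2]; simp [mask]
      have e2 : input2 P g (mask {.w n} ω) n = input2 P g ω n := by
        refine congrArg (g.2 n) (funext fun i => ?_)
        simp only [obs2, hs i i.2]; simp [mask]
      rw [state_succ, state_succ, e1, e2, hs n (by omega)]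
      simp [mask]
      ring
  simpa [Params.var] using h

/-! ### Linear strategies -/

lemma measurable_of_mem_linearStrategies {g : Strategy × Strategy} (hg : g ∈ linearStrategies)
    (n : ℕ) : Measurable (g.1 n) ∧ Measurable (g.2 n) := by
  obtain ⟨k, k', h⟩ := hg
  constructor
  · refine measurable_of_input ?_
    simp only [(h _ n).1]
    fun_prop
  · refine measurable_of_input ?_
    simp only [(h _ n).2]
    fun_prop

/-- The trade-off behind the lower bound. Let `x` be the state at a time `n + 1`, of which the
fresh noise `w` is one summand, and let `v`, `v'` be the observation noises of the second controller
at the times `n + 1` and `n + 2`. With `k`, `p`, `q` the gains of the first controller and `k'`,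
`p'`, `q'` those of the second, the summands are the squared coefficients of `w`, `v`, `v'` in
`u1[n+1]`, `u1[n+2]` and `x[n+3]`, weighted by the variances and the cost weights. If the first
controller uses little energy, then the coefficient of `w` in `x[n+3]` is about `a ^ 2` unless the
second controller amplifies `v` or `v'`. -/
lemma gain_tradeoff {a : ℝ} (ha : 1 ≤ a) (k p q k' p' q' : ℝ) :
    a ^ 3 / 400 ≤ a * k ^ 2 + a * ((p * (a + k + k') + q) ^ 2 + a * (p * k') ^ 2)
      + (((a + p + p') * (a + k + k') + q + q') ^ 2
        + a * ((a + p + p') * k' + q') ^ 2 + a * p' ^ 2) := by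
  by_contra! hlt
  have ha0 : 0 < a := by linarith
  have key : ∀ z, a * z ^ 2 < a ^ 3 / 400 → |z| ≤ a / 20 := by
    intro z hz
    refine abs_le_of_sq_le_sq ?_ (by positivity)
    have : a * (a / 20) ^ 2 = a ^ 3 / 400 := by ring
    exact le_of_mul_le_mul_left (hz.le.trans this.ge) ha0
  have s1 : 0 ≤ a * k ^ 2 := by positivity
  have s2 : 0 ≤ a * (p * (a + k + k') + q) ^ 2 := by positivity
  have s3 : 0 ≤ a * (p * k') ^ 2 := by positivity
  have s3' : a * (p * k') ^ 2 ≤ a * (a * (p * k') ^ 2) :=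
    mul_le_mul_of_nonneg_left (le_mul_of_one_le_left (sq_nonneg _) ha) ha0.le
  have s4 : 0 ≤ ((a + p + p') * (a + k + k') + q + q') ^ 2 := by positivity
  have s5 : 0 ≤ a * ((a + p + p') * k' + q') ^ 2 := by positivity
  have s6 : 0 ≤ a * p' ^ 2 := by positivity
  have hk := abs_le.1 (key k (by linarith))
  have hG := abs_le.1 (key (p * (a + k + k') + q) (by linarith))
  have hδ := abs_le.1 (key (p * k') (by linarith))
  have hβ := abs_le.1 (key ((a + p + p') * k' + q') (by linarith))
  have hp' := key p' (by linarith)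
  have hα : |(a + p + p') * (a + k + k') + q + q'| ≤ a ^ 2 / 20 := by
    refine abs_le_of_sq_le_sq ?_ (by positivity)
    have : a ^ 3 ≤ a ^ 4 := pow_le_pow_right₀ ha (by norm_num)
    rw [show (a ^ 2 / 20) ^ 2 = a ^ 4 / 400 by ring]
    linarith
  have hα := abs_le.1 hα
  have hpb : |p' * (a + k)| ≤ a / 20 * (2 * a) := by
    rw [abs_mul]
    gcongr
    rw [abs_le]
    constructor <;> linarith
  have hpb := abs_le.1 hpb
  -- The leading term `a * (a + k)` is expressed through quantities that are all of smaller size.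
  have hid : a * (a + k) = ((a + p + p') * (a + k + k') + q + q') - ((a + p + p') * k' + q')
      - ((p * (a + k + k') + q) - p * k') - p' * (a + k) := by ring
  have hlow : a * (19 / 20 * a) ≤ a * (a + k) := by gcongr; linarith
  have hsq : a ≤ a ^ 2 := le_self_pow₀ ha (by norm_num)
  have hpos : 0 < a ^ 2 := by positivity
  rw [hid] at hlow
  rw [show a * (19 / 20 * a) = 19 / 20 * a ^ 2 by ring] at hlow
  rw [show a / 20 * (2 * a) = a ^ 2 / 10 by ring] at hpb
  linarith [hα.2, hβ.1, hG.1, hδ.2, hpb.1]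

lemma state_succ_of_linear (P : Params) {g : Strategy × Strategy} {k k' : ℕ → ℕ → ℝ}
    (h : ∀ (y : ℕ → ℝ) (n : ℕ), g.1.input y n = ∑ i ∈ Finset.range (n + 1), k n i * y i ∧
      g.2.input y n = ∑ i ∈ Finset.range (n + 1), k' n i * y i) (ω : Noise → ℝ) (n : ℕ) :
    state P g ω (n + 1) = P.a * state P g ω n
      + ∑ i ∈ Finset.range (n + 1), k n i * obs1 P g ω i
      + ∑ i ∈ Finset.range (n + 1), k' n i * obs2 P g ω i + ω (.w n) := by
  rw [state_succ, input1, input2, (h _ n).1, (h _ n).2]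

open Classical in
lemma le_secondMoment_of_coeff {a : ℝ} (ha : 0 < a) (n : ℕ) (α β γ : ℝ)
    {X : (Noise → ℝ) → ℝ} (hX : Measurable X)
    (h : ∀ ω, X ω = α * ω (.w n) + β * ω (.v2 (n + 1)) + γ * ω (.v2 (n + 2))
      + X (mask {.w n, .v2 (n + 1), .v2 (n + 2)} ω)) :
    ENNReal.ofReal (α ^ 2 + a * β ^ 2 + a * γ ^ 2) ≤ secondMoment (params a) X := by
  have := sum_le_secondMoment (P := params a) {.w n, .v2 (n + 1), .v2 (n + 2)}
    (fun i => if i = .w n then α else if i = .v2 (n + 1) then β else γ) hX fun ω => by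
      rw [h ω, Finset.sum_insert (by simp), Finset.sum_insert (by simp), Finset.sum_singleton]
      simp
      ring
  refine le_trans (le_of_eq ?_) this
  rw [Finset.sum_insert (by simp), Finset.sum_insert (by simp), Finset.sum_singleton]
  simp only [params, Params.var]
  simp
  rw [ENNReal.ofReal_add (by positivity) (by positivity),
    ENNReal.ofReal_add (by positivity) (by positivity), ENNReal.ofReal_mul ha.le,
    ENNReal.ofReal_mul ha.le, mul_comm (ENNReal.ofReal a), mul_comm (ENNReal.ofReal a), add_assoc]
  rfl

open Classical in
lemma le_stageCost_of_linear {a : ℝ} (ha : 1 ≤ a) {g : Strategy × Strategy}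
    (hg : g ∈ linearStrategies) (n : ℕ) :
    ENNReal.ofReal (a ^ 3 / 400) ≤ stageCost (params a) g (n + 1)
      + stageCost (params a) g (n + 2) + stageCost (params a) g (n + 3) := by
  have ha0 : 0 < a := by linarith
  have hm1 := fun n => (measurable_of_mem_linearStrategies hg n).1
  have hm2 := fun n => (measurable_of_mem_linearStrategies hg n).2
  obtain ⟨k, k', h⟩ := hg
  set P := params a with hP
  have hPa : P.a = a := rfl
  set s : Finset Noise := {.w n, .v2 (n + 1), .v2 (n + 2)} with hs
  -- Each variable is compared with its value when the three noises are set to `0`: up to time `n`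
  -- nothing changes, and `d1`, `d2` record the change of the state at times `n + 1`, `n + 2`.
  have hold : ∀ ω, ∀ m < n + 1, state P g ω m = state P g (mask s ω) m := by
    intro ω m hm
    refine state_congr P g (by simp [mask, hs]) m fun l hl => ?_
    have h1 : l ≠ n := by omega
    have h2 : l ≠ n + 1 := by omega
    have h3 : l ≠ n + 2 := by omega
    simp [mask, hs, h1, h2, h3]
  have ho1 : ∀ ω m, obs1 P g ω m
      = obs1 P g (mask s ω) m + (state P g ω m - state P g (mask s ω) m) := by
    intro ω m
    simp [obs1, mask, hs]
    ring
  have ho2 : ∀ ω, ∀ m < n + 1, obs2 P g ω m = obs2 P g (mask s ω) m := by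
    intro ω m hm
    have h2 : m ≠ n + 1 := by omega
    have h3 : m ≠ n + 2 := by omega
    simp [obs2, hold ω m hm, mask, hs, h2, h3]
  have sum1 : ∀ ω m, ∑ i ∈ Finset.range (n + 1), k m i * obs1 P g ω i
      = ∑ i ∈ Finset.range (n + 1), k m i * obs1 P g (mask s ω) i := by
    intro ω m
    refine Finset.sum_congr rfl fun i hi => ?_
    rw [ho1, hold ω i (Finset.mem_range.1 hi), sub_self, add_zero]
  have sum2 : ∀ ω m, ∑ i ∈ Finset.range (n + 1), k' m i * obs2 P g ω i
      = ∑ i ∈ Finset.range (n + 1), k' m i * obs2 P g (mask s ω) i := by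
    intro ω m
    refine Finset.sum_congr rfl fun i hi => ?_
    rw [ho2 ω i (Finset.mem_range.1 hi)]
  have d1 : ∀ ω, state P g ω (n + 1) = ω (.w n) + state P g (mask s ω) (n + 1) := by
    intro ω
    rw [state_succ_of_linear P h, state_succ_of_linear P h, sum1, sum2,
      hold ω n (by omega)]
    simp [mask, hs]
    ring
  have ho2' : ∀ ω, obs2 P g ω (n + 1)
      = obs2 P g (mask s ω) (n + 1) + ω (.w n) + ω (.v2 (n + 1)) := by
    intro ω
    simp only [obs2, d1 ω]
    simp [mask, hs]
    ring
  have d2 : ∀ ω, state P g ω (n + 2)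
      = (a + k (n + 1) (n + 1) + k' (n + 1) (n + 1)) * ω (.w n)
        + k' (n + 1) (n + 1) * ω (.v2 (n + 1)) + state P g (mask s ω) (n + 2) := by
    intro ω
    rw [state_succ_of_linear P h ω (n + 1), state_succ_of_linear P h (mask s ω) (n + 1),
      Finset.sum_range_succ _ (n + 1), Finset.sum_range_succ _ (n + 1),
      Finset.sum_range_succ _ (n + 1), Finset.sum_range_succ _ (n + 1), sum1, sum2, ho1 ω (n + 1),
      ho2' ω, d1 ω, hPa]
    simp [mask, hs]
    ring
  have ho2'' : ∀ ω, obs2 P g ω (n + 2) = obs2 P g (mask s ω) (n + 2)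
      + (state P g ω (n + 2) - state P g (mask s ω) (n + 2)) + ω (.v2 (n + 2)) := by
    intro ω
    simp only [obs2]
    simp [mask, hs]
  set b := a + k (n + 1) (n + 1) + k' (n + 1) (n + 1) with hb
  have e1 := le_secondMoment_of_coeff ha0 n (k (n + 1) (n + 1)) 0 0
    (measurable_input1 P hm1 hm2 (n + 1)) fun ω => by
      rw [input1, input1, (h _ _).1, (h _ _).1, Finset.sum_range_succ _ (n + 1),
        Finset.sum_range_succ _ (n + 1), sum1, ho1 ω (n + 1), d1 ω]
      ring
  have e2 := le_secondMoment_of_coeff ha0 n (k (n + 2) (n + 2) * b + k (n + 2) (n + 1))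
    (k (n + 2) (n + 2) * k' (n + 1) (n + 1)) 0
    (measurable_input1 P hm1 hm2 (n + 2)) fun ω => by
      rw [input1, input1, (h _ _).1, (h _ _).1, Finset.sum_range_succ _ (n + 2),
        Finset.sum_range_succ _ (n + 2), Finset.sum_range_succ _ (n + 1),
        Finset.sum_range_succ _ (n + 1), sum1, ho1 ω (n + 1), ho1 ω (n + 2), d2 ω, d1 ω]
      ring
  have e3 := le_secondMoment_of_coeff ha0 n
    ((a + k (n + 2) (n + 2) + k' (n + 2) (n + 2)) * b + k (n + 2) (n + 1) + k' (n + 2) (n + 1))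
    ((a + k (n + 2) (n + 2) + k' (n + 2) (n + 2)) * k' (n + 1) (n + 1) + k' (n + 2) (n + 1))
    (k' (n + 2) (n + 2))
    (measurable_state P hm1 hm2 (n + 3)) fun ω => by
      rw [state_succ_of_linear P h ω (n + 2), state_succ_of_linear P h (mask _ ω) (n + 2),
        Finset.sum_range_succ _ (n + 2), Finset.sum_range_succ _ (n + 2),
        Finset.sum_range_succ _ (n + 2), Finset.sum_range_succ _ (n + 2),
        Finset.sum_range_succ _ (n + 1), Finset.sum_range_succ _ (n + 1),
        Finset.sum_range_succ _ (n + 1), Finset.sum_range_succ _ (n + 1), sum1, sum2,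
        ho1 ω (n + 1), ho1 ω (n + 2), ho2' ω, ho2'' ω, d2 ω, d1 ω, hPa]
      simp [mask, hs]
      ring
  have f1 : ENNReal.ofReal (a * k (n + 1) (n + 1) ^ 2) ≤ stageCost P g (n + 1) := by
    rw [ENNReal.ofReal_mul ha0.le]
    refine le_trans ?_ (le_trans le_add_self le_self_add)
    refine mul_le_mul' le_rfl (le_trans (ENNReal.ofReal_le_ofReal ?_) e1)
    simp
  have f2 : ENNReal.ofReal (a * ((k (n + 2) (n + 2) * b + k (n + 2) (n + 1)) ^ 2
      + a * (k (n + 2) (n + 2) * k' (n + 1) (n + 1)) ^ 2)) ≤ stageCost P g (n + 2) := by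
    rw [ENNReal.ofReal_mul ha0.le]
    refine le_trans ?_ (le_trans le_add_self le_self_add)
    refine mul_le_mul' le_rfl (le_trans (ENNReal.ofReal_le_ofReal ?_) e2)
    simp
  have f3 := e3.trans (show _ ≤ stageCost P g (n + 3) by
    rw [stageCost, hP, show (params a).q = 1 from rfl, ENNReal.coe_one, one_mul, add_assoc]
    exact le_self_add)
  refine le_trans ?_ (add_le_add (add_le_add f1 f2) f3)
  rw [← ENNReal.ofReal_add (by positivity) (by positivity),
    ← ENNReal.ofReal_add (by positivity) (by positivity)]
  exact ENNReal.ofReal_le_ofReal (gain_tradeoff ha _ _ _ _ _ _)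

lemma le_linCost {a : ℝ} (ha : 1 ≤ a) : ENNReal.ofReal (a ^ 3 / 1600) ≤ linCost a := by
  refine le_iInf₂ fun g hg => le_trans (le_of_eq ?_) (le_avgCost (le_stageCost_of_linear ha hg))
  rw [← ENNReal.ofReal_ofNat 4, ← ENNReal.ofReal_div_of_pos (by norm_num)]
  congr 1
  ring

/-- The first controller can cancel `a x[n]` on its own, at a finite cost. -/
lemma linCost_ne_top (a : ℝ) : linCost a ≠ ∞ := by
  let g : Strategy × Strategy := (fun n f => -a * f (Fin.last n), fun _ _ => 0)
  have hg : g ∈ linearStrategies := by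
    refine ⟨fun n i => if i = n then -a else 0, fun _ _ => 0, fun y n => ?_⟩
    simp [g, Strategy.input]
  have hin1 : ∀ ω n, input1 (params a) g ω n = -a * (state (params a) g ω n + ω (.v1 n)) := by
    intro ω n; simp [input1, Strategy.input, g, obs1]
  have hstate : ∀ n, ∀ᵐ ω ∂(params a).law, state (params a) g ω (n + 1) = ω (.w n) := by
    intro n
    filter_upwards [ae_noise_eq_zero (P := params a) (i := .v1 n) rfl] with ω hω
    rw [state_succ, hin1, hω]
    simp [input2, Strategy.input, g, params]
  have hx : ∀ n, secondMoment (params a) (fun ω => state (params a) g ω n) ≤ 1 := by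
    intro n
    cases n with
    | zero =>
      simp only [state]
      rw [secondMoment_noise]
      simp [params, Params.var]
    | succ n =>
      rw [secondMoment_congr_ae (hstate n), secondMoment_noise]
      simp [Params.var]
  have hu : ∀ n, secondMoment (params a) (fun ω => input1 (params a) g ω n)
      ≤ ENNReal.ofReal (a ^ 2) := by
    intro n
    have hae : ∀ᵐ ω ∂(params a).law,
        input1 (params a) g ω n = -a * state (params a) g ω n := by
      filter_upwards [ae_noise_eq_zero (P := params a) (i := .v1 n) rfl] with ω hω
      rw [hin1, hω, add_zero]
    rw [secondMoment_congr_ae hae]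
    calc secondMoment (params a) (fun ω => -a * state (params a) g ω n)
        = ENNReal.ofReal (a ^ 2) * secondMoment (params a) (fun ω => state (params a) g ω n) := by
          unfold secondMoment
          rw [← lintegral_const_mul' _ _ ENNReal.ofReal_ne_top]
          refine lintegral_congr fun ω => ?_
          rw [← ENNReal.ofReal_mul (sq_nonneg a)]
          congr 1
          ring
      _ ≤ _ := by simpa using mul_le_mul' (le_refl (ENNReal.ofReal (a ^ 2))) (hx n)
  have hB : ∀ n, stageCost (params a) g n ≤ 1 + ENNReal.ofReal a * ENNReal.ofReal (a ^ 2) := by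
    intro n
    simp only [stageCost, show (params a).q = 1 from rfl, show (params a).r2 = 0 from rfl,
      show (params a).r1 = a.toNNReal from rfl, ENNReal.coe_one, ENNReal.coe_zero, one_mul,
      zero_mul, add_zero]
    exact add_le_add (hx n) (mul_le_mul' le_rfl (hu n))
  refine ne_top_of_le_ne_top ?_ ((iInf₂_le g hg).trans (avgCost_le hB))
  finiteness

/-! ### The quantizer -/

lemma measurable_quant (x : ℝ) : Measurable (quant x) := by
  unfold quant
  have : Measurable fun y : ℝ => ⌊y / x + 1 / 2⌋ := Int.measurable_floor.comp (by fun_prop)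
  have h2 : Measurable fun y : ℝ => ((⌊y / x + 1 / 2⌋ : ℤ) : ℝ) :=
    (measurable_from_top (f := fun z : ℤ => (z : ℝ))).comp this
  exact h2.const_mul x

lemma measurable_rmdr (x : ℝ) : Measurable (rmdr x) :=
  measurable_id.sub (measurable_quant x)

lemma abs_rmdr_le {x : ℝ} (hx : 0 < x) (y : ℝ) : |rmdr x y| ≤ x / 2 := by
  have h1 := Int.floor_le (y / x + 1 / 2)
  have h2 := Int.lt_floor_add_one (y / x + 1 / 2)
  have hy : x * (y / x + 1 / 2) = y + x / 2 := by field_simp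
  have h1' := mul_le_mul_of_nonneg_left h1 hx.le
  have h2' := mul_le_mul_of_nonneg_left h2.le hx.le
  rw [hy] at h1' h2'
  rw [rmdr, quant, abs_le]
  constructor <;> linarith

lemma quant_mul_int_add {x : ℝ} (hx : x ≠ 0) (m : ℤ) (y : ℝ) :
    quant x (x * m + y) = x * m + quant x y := by
  have : (x * m + y) / x + 1 / 2 = (y / x + 1 / 2) + m := by field_simp; ring
  rw [quant, quant, this, Int.floor_add_intCast]
  push_cast
  ring

lemma rmdr_zero (x : ℝ) : rmdr x 0 = 0 := by
  have : ⌊(1 / 2 : ℝ)⌋ = 0 := by rw [Int.floor_eq_zero_iff]; norm_num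
  simp only [rmdr, quant, zero_div, zero_add, this]
  simp

/-- Exponential tail of the quantizer: it vanishes on `|y| < x / 2` and is at most `2 |y|`
elsewhere. -/
lemma sq_quant_le {x : ℝ} (hx : 0 < x) {t : ℝ} (ht : 0 < t) (y : ℝ) :
    quant x y ^ 2 ≤ 8 / t ^ 2 * Real.exp (-(t * x / 2)) * Real.exp (2 * t * |y|) := by
  rcases lt_or_ge |y| (x / 2) with hy | hy
  · have h0 : ⌊y / x + 1 / 2⌋ = 0 := by
      obtain ⟨h1, h2⟩ := abs_lt.1 hy
      have e1 : -(1 / 2) < y / x := by rw [lt_div_iff₀ hx]; linarith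
      have e2 : y / x < 1 / 2 := by rw [div_lt_iff₀ hx]; linarith
      rw [Int.floor_eq_zero_iff]
      constructor <;> linarith
    rw [quant, h0]
    simp only [Int.cast_zero, mul_zero, zero_pow two_ne_zero]
    positivity
  · have hq : |quant x y| ≤ 2 * |y| := by
      have h1 : quant x y = y - rmdr x y := by rw [rmdr]; ring
      rw [h1]
      calc |y - rmdr x y| ≤ |y| + |rmdr x y| := abs_sub _ _
        _ ≤ 2 * |y| := by linarith [abs_rmdr_le hx y]
    have hq2 : quant x y ^ 2 ≤ 4 * |y| ^ 2 := by
      rw [← sq_abs]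
      nlinarith [abs_nonneg (quant x y), abs_nonneg y]
    have hexp : (t * |y|) ^ 2 / 2 ≤ Real.exp (t * |y|) := by
      have := Real.quadratic_le_exp_of_nonneg (x := t * |y|) (by positivity)
      have : 0 ≤ t * |y| := by positivity
      linarith
    calc quant x y ^ 2 ≤ 8 / t ^ 2 * ((t * |y|) ^ 2 / 2) := by
          refine hq2.trans (le_of_eq ?_)
          field_simp
          ring
      _ ≤ 8 / t ^ 2 * Real.exp (t * |y|) := by gcongr
      _ ≤ 8 / t ^ 2 * Real.exp (-(t * x / 2) + 2 * t * |y|) := by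
          gcongr
          nlinarith
      _ = _ := by rw [Real.exp_add]; ring

lemma exp_abs_add_le {t : ℝ} (ht : 0 ≤ t) (w v : ℝ) :
    Real.exp (2 * t * |w + v|) ≤ Real.exp (4 * t * w) + Real.exp (-(4 * t) * w)
      + (Real.exp (4 * t * v) + Real.exp (-(4 * t) * v)) := by
  have habs : ∀ z, Real.exp (4 * t * |z|) ≤ Real.exp (4 * t * z) + Real.exp (-(4 * t) * z) := by
    intro z
    rcases abs_cases z with ⟨h, -⟩ | ⟨h, -⟩ <;> rw [h]
    · linarith [Real.exp_pos (-(4 * t) * z)]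
    · rw [mul_neg, ← neg_mul]
      linarith [Real.exp_pos (4 * t * z)]
  have hadd := abs_add_le w v
  rcases le_total |w| |v| with h | h
  · have : Real.exp (2 * t * |w + v|) ≤ Real.exp (4 * t * |v|) :=
      Real.exp_le_exp.2 (by nlinarith)
    linarith [habs v, Real.exp_pos (4 * t * w), Real.exp_pos (-(4 * t) * w)]
  · have : Real.exp (2 * t * |w + v|) ≤ Real.exp (4 * t * |w|) :=
      Real.exp_le_exp.2 (by nlinarith)
    linarith [habs w, Real.exp_pos (4 * t * v), Real.exp_pos (-(4 * t) * v)]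

/-! ### Signaling strategies -/

/-- The pair `g` is the 1-stage signaling strategy with quantizer step `d`. -/
def IsSignaling (a d : ℝ) (g : Strategy × Strategy) : Prop :=
  ∀ (y : ℕ → ℝ) (n : ℕ), g.1.input y n = -a * rmdr d (y n) ∧
    g.2.input y n =
      -a * (quant (a ^ 1 * d) (y n - rmdr (a ^ 1 * d) (pastSum a 1 (g.2.input y) n))
        + rmdr (a ^ 1 * d) (pastSum a 1 (g.2.input y) n))

lemma pastSum_one_zero (a : ℝ) (u : ℕ → ℝ) : pastSum a 1 u 0 = 0 := by
  simp [pastSum]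

lemma pastSum_one_succ (a : ℝ) (u : ℕ → ℝ) (n : ℕ) : pastSum a 1 u (n + 1) = u n := by
  simp [pastSum]

/-- The input of the second controller in the 1-stage signaling strategy with cell width `D`,
as a function of the whole observation sequence. -/
noncomputable def signalingInput (a D : ℝ) (y : ℕ → ℝ) : ℕ → ℝ
  | 0 => -a * quant D (y 0)
  | n + 1 => -a * (quant D (y (n + 1) - rmdr D (signalingInput a D y n))
      + rmdr D (signalingInput a D y n))

lemma signalingInput_congr (a D : ℝ) {y y' : ℕ → ℝ} (n : ℕ) (h : ∀ i ≤ n, y i = y' i) :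
    signalingInput a D y n = signalingInput a D y' n := by
  induction n with
  | zero => rw [signalingInput, signalingInput, h 0 le_rfl]
  | succ n ih =>
    rw [signalingInput, signalingInput, ih fun i hi => h i (hi.trans n.le_succ), h _ le_rfl]

/-- The 1-stage signaling strategy with quantizer step `d`. -/
noncomputable def signaling (a d : ℝ) : Strategy × Strategy :=
  (fun n f => -a * rmdr d (f (Fin.last n)), fun n f => signalingInput a (a * d) (extend n f) n)

lemma isSignaling_signaling (a d : ℝ) : IsSignaling a d (signaling a d) := by
  have h2 : ∀ y, (signaling a d).2.input y = signalingInput a (a * d) y := by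
    intro y
    funext n
    refine signalingInput_congr a (a * d) n fun i hi => ?_
    simp [extend, Nat.lt_succ_of_le hi]
  refine fun y n => ⟨by simp [signaling, Strategy.input], ?_⟩
  rw [h2, pow_one]
  cases n with
  | zero => simp [pastSum_one_zero, rmdr_zero, signalingInput]
  | succ n => rw [pastSum_one_succ, signalingInput]

lemma measurable_of_mem_signalingStrategies {a : ℝ} {g : Strategy × Strategy}
    (hg : g ∈ signalingStrategies a 1) (n : ℕ) : Measurable (g.1 n) ∧ Measurable (g.2 n) := by
  obtain ⟨d, -, h⟩ := hg
  constructor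
  · refine measurable_of_input ?_
    simp only [(h _ n).1]
    exact ((measurable_rmdr d).comp (measurable_pi_apply n)).const_mul _
  · refine measurable_of_input ?_
    have key : ∀ n {c : (ℕ → ℝ) → ℝ}, Measurable c →
        Measurable fun y : ℕ → ℝ => -a * (quant (a ^ 1 * d) (y n - rmdr (a ^ 1 * d) (c y))
          + rmdr (a ^ 1 * d) (c y)) := by
      intro n c hc
      have hr := (measurable_rmdr (a ^ 1 * d)).comp hc
      exact (((measurable_quant _).comp ((measurable_pi_apply n).sub hr)).add hr).const_mul _
    induction n with
    | zero =>
      simp only [(h _ 0).2, pastSum_one_zero]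
      exact key 0 measurable_const
    | succ n ih =>
      simp only [(h _ (n + 1)).2, pastSum_one_succ]
      exact key (n + 1) ih

/-- The process noise that has just entered the state at time `n`; it is `0` at time `0`. -/
def prevNoise (ω : Noise → ℝ) : ℕ → ℝ
  | 0 => 0
  | n + 1 => ω (.w n)

lemma measurable_prevNoise (n : ℕ) : Measurable fun ω => prevNoise ω n := by
  cases n <;> simp only [prevNoise] <;> fun_prop

lemma secondMoment_prevNoise_le (P : Params) (n : ℕ) :
    secondMoment P (fun ω => prevNoise ω n) ≤ 1 := by
  cases n with
  | zero => simp [prevNoise, secondMoment]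
  | succ n => simp only [prevNoise]; rw [secondMoment_noise]; simp [Params.var]

lemma lintegral_exp_prevNoise_le (P : Params) (n : ℕ) (t : ℝ) :
    ∫⁻ ω, ENNReal.ofReal (Real.exp (t * prevNoise ω n)) ∂P.law
      ≤ ENNReal.ofReal (Real.exp (t ^ 2 / 2)) := by
  cases n with
  | zero =>
    simp only [prevNoise, mul_zero, Real.exp_zero, lintegral_const, measure_univ, mul_one]
    exact ENNReal.ofReal_le_ofReal (Real.one_le_exp (by positivity))
  | succ n => simp only [prevNoise]; rw [lintegral_exp_noise]; simp [Params.var]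

/-- Since the first controller leaves a multiple of `a d` in the state, the state differs from
the residue of the last input of the second controller by a multiple of `a d` and the fresh noise.
-/
lemma exists_state_eq_of_signaling {a d : ℝ} {g : Strategy × Strategy}
    (h : ∀ (y : ℕ → ℝ) (n : ℕ), g.1.input y n = -a * rmdr d (y n)) {ω : Noise → ℝ}
    (h0 : ω .x0 = 0) (hv : ∀ n, ω (.v1 n) = 0) (n : ℕ) :
    ∃ m : ℤ, state (params a) g ω n = a * d * m
      + rmdr (a * d) (pastSum a 1 (g.2.input (obs2 (params a) g ω)) n) + prevNoise ω n := by
  cases n with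
  | zero => exact ⟨0, by simp [state, h0, pastSum_one_zero, rmdr_zero, prevNoise]⟩
  | succ n =>
    refine ⟨⌊state (params a) g ω n / d + 1 / 2⌋
      + ⌊input2 (params a) g ω n / (a * d) + 1 / 2⌋, ?_⟩
    rw [state_succ, input1, h, pastSum_one_succ]
    change _ = _ + rmdr (a * d) (input2 (params a) g ω n) + _
    simp only [obs1, hv, add_zero, params, prevNoise, rmdr, quant]
    push_cast
    ring

/-- The closed loop: the second controller recovers `x[n] - w[n-1]` up to the quantized noise, and
the quantizer step keeps the correction of the first controller small. -/
lemma state_succ_of_signaling {a d : ℝ} (ha : 0 < a) (hd : 0 < d) {g : Strategy × Strategy}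
    (h : IsSignaling a d g) {ω : Noise → ℝ}
    (h0 : ω .x0 = 0) (hv : ∀ n, ω (.v1 n) = 0) (n : ℕ) :
    state (params a) g ω (n + 1) = a * (prevNoise ω n
      - quant (a * d) (prevNoise ω n + ω (.v2 n)) - rmdr d (state (params a) g ω n))
      + ω (.w n) := by
  obtain ⟨m, hm⟩ := exists_state_eq_of_signaling (fun y n => (h y n).1) h0 hv n
  have hy : obs2 (params a) g ω n
      - rmdr (a * d) (pastSum a 1 (g.2.input (obs2 (params a) g ω)) n)
      = a * d * m + (prevNoise ω n + ω (.v2 n)) := by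
    rw [obs2, hm]; ring
  rw [state_succ, input1, input2, (h _ _).1, (h _ _).2, pow_one, hy,
    quant_mul_int_add (by positivity)]
  simp only [obs1, hv, add_zero, show (params a).a = a from rfl]
  generalize rmdr d (state (params a) g ω n) = r
  rw [hm]
  ring

lemma secondMoment_state_of_signaling_le {a d t : ℝ} (ha : 1 ≤ a) (hd : 0 < d) (ht : 0 < t)
    {g : Strategy × Strategy}
    (h : IsSignaling a d g) (n : ℕ) :
    secondMoment (params a) (fun ω => state (params a) g ω n)
      ≤ ENNReal.ofReal (6 * a ^ 2 * (1 + d ^ 2 / 4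
        + 32 / t ^ 2 * Real.exp (-(t * (a * d) / 2)) * Real.exp (8 * a * t ^ 2)) + 2) := by
  have ha0 : 0 < a := by linarith
  have hx0 := ae_noise_eq_zero (P := params a) (i := .x0) rfl
  have hv1 : ∀ᵐ ω ∂(params a).law, ∀ n, ω (.v1 n) = 0 :=
    ae_all_iff.2 fun n => ae_noise_eq_zero (P := params a) (i := .v1 n) rfl
  cases n with
  | zero =>
    simp only [state]
    rw [secondMoment_noise]
    simp [params, Params.var]
  | succ n =>
    set K := 8 / t ^ 2 * Real.exp (-(t * (a * d) / 2)) with hK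
    have hK0 : 0 ≤ K := by positivity
    have hpt : ∀ᵐ ω ∂(params a).law, ENNReal.ofReal (state (params a) g ω (n + 1) ^ 2)
        ≤ ENNReal.ofReal (6 * a ^ 2) * ENNReal.ofReal (prevNoise ω n ^ 2)
          + ENNReal.ofReal (6 * a ^ 2 * (d ^ 2 / 4))
          + ENNReal.ofReal (6 * a ^ 2 * K) *
            (ENNReal.ofReal (Real.exp (4 * t * prevNoise ω n))
              + ENNReal.ofReal (Real.exp (-(4 * t) * prevNoise ω n))
              + (ENNReal.ofReal (Real.exp (4 * t * ω (.v2 n)))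
                + ENNReal.ofReal (Real.exp (-(4 * t) * ω (.v2 n)))))
          + ENNReal.ofReal 2 * ENNReal.ofReal (ω (.w n) ^ 2) := by
      filter_upwards [hx0, hv1] with ω h0 hv
      rw [← ENNReal.ofReal_mul (by positivity), ← ENNReal.ofReal_mul (by positivity),
        ← ENNReal.ofReal_add (by positivity) (by positivity),
        ← ENNReal.ofReal_add (by positivity) (by positivity),
        ← ENNReal.ofReal_add (by positivity) (by positivity),
        ← ENNReal.ofReal_add (by positivity) (by positivity),
        ← ENNReal.ofReal_mul (by positivity),
        ← ENNReal.ofReal_add (by positivity) (by positivity),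
        ← ENNReal.ofReal_add (by positivity) (by positivity)]
      refine ENNReal.ofReal_le_ofReal ?_
      rw [state_succ_of_signaling ha0 hd h h0 hv]
      have hr : rmdr d (state (params a) g ω n) ^ 2 ≤ d ^ 2 / 4 := by
        rw [show d ^ 2 / 4 = (d / 2) ^ 2 by ring]
        exact sq_le_sq' (abs_le.1 (abs_rmdr_le hd _)).1 (abs_le.1 (abs_rmdr_le hd _)).2
      have hq := (sq_quant_le (x := a * d) (by positivity) ht (prevNoise ω n + ω (.v2 n))).trans
        (mul_le_mul_of_nonneg_left (exp_abs_add_le ht.le (prevNoise ω n) (ω (.v2 n))) hK0)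
      generalize rmdr d (state (params a) g ω n) = r at hr ⊢
      generalize quant (a * d) (prevNoise ω n + ω (.v2 n)) = q at hq ⊢
      generalize Real.exp (4 * t * prevNoise ω n) + Real.exp (-(4 * t) * prevNoise ω n)
        + (Real.exp (4 * t * ω (.v2 n)) + Real.exp (-(4 * t) * ω (.v2 n))) = S at hq ⊢
      generalize prevNoise ω n = p
      generalize ω (.w n) = w
      have h3 : (p - q - r) ^ 2 ≤ 3 * (p ^ 2 + K * S + d ^ 2 / 4) := by
        nlinarith [sq_nonneg (p + q), sq_nonneg (p + r), sq_nonneg (q - r)]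
      have h4 := mul_le_mul_of_nonneg_left h3 (sq_nonneg a)
      nlinarith [sq_nonneg (a * (p - q - r) - w)]
    refine (lintegral_mono_ae hpt).trans ?_
    have hmp := measurable_prevNoise n
    rw [lintegral_add_left (by fun_prop), lintegral_add_left (by fun_prop),
      lintegral_add_left (by fun_prop), lintegral_const_mul _ (by fun_prop),
      lintegral_const_mul _ (by fun_prop), lintegral_const_mul _ (by fun_prop),
      lintegral_add_left (by fun_prop), lintegral_add_left (by fun_prop),
      lintegral_add_left (by fun_prop), lintegral_const, measure_univ, mul_one,
      lintegral_exp_noise, lintegral_exp_noise]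
    have hw := secondMoment_noise (params a) (.w n)
    have hp := secondMoment_prevNoise_le (params a) n
    unfold secondMoment at hw hp
    have hE : ∀ s : ℝ, s ^ 2 = 16 * t ^ 2 →
        ∫⁻ ω, ENNReal.ofReal (Real.exp (s * prevNoise ω n)) ∂(params a).law
          ≤ ENNReal.ofReal (Real.exp (8 * a * t ^ 2)) := by
      intro s hs
      refine (lintegral_exp_prevNoise_le _ n s).trans (ENNReal.ofReal_le_ofReal ?_)
      rw [hs, Real.exp_le_exp]
      nlinarith [sq_nonneg t]
    have hvar : ((params a).var (.v2 n) : ℝ) = a := by simp [params, Params.var, ha0.le]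
    rw [hw, hvar, show a * (4 * t) ^ 2 / 2 = 8 * a * t ^ 2 by ring,
      show a * (-(4 * t)) ^ 2 / 2 = 8 * a * t ^ 2 by ring]
    refine (add_le_add (add_le_add (add_le_add (mul_le_mul' le_rfl hp) le_rfl)
      (mul_le_mul' le_rfl (add_le_add (add_le_add (hE (4 * t) (by ring)) (hE (-(4 * t)) (by ring)))
        le_rfl))) le_rfl).trans (le_of_eq ?_)
    simp only [Params.var, ENNReal.coe_one, mul_one]
    rw [← ENNReal.ofReal_add (by positivity) (by positivity),
      ← ENNReal.ofReal_add (by positivity) (by positivity),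
      ← ENNReal.ofReal_add (by positivity) (by positivity),
      ← ENNReal.ofReal_mul (by positivity),
      ← ENNReal.ofReal_add (by positivity) (by positivity),
      ← ENNReal.ofReal_add (by positivity) (by positivity)]
    congr 1
    rw [hK]
    ring

lemma secondMoment_input1_of_signaling_le {P : Params} {a d : ℝ} (hd : 0 < d)
    {g : Strategy × Strategy}
    (h : ∀ (y : ℕ → ℝ) (n : ℕ), g.1.input y n = -a * rmdr d (y n)) (n : ℕ) :
    secondMoment P (fun ω => input1 P g ω n) ≤ ENNReal.ofReal (a ^ 2 * (d ^ 2 / 4)) := by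
  have hle : ∀ ω, ENNReal.ofReal (input1 P g ω n ^ 2) ≤ ENNReal.ofReal (a ^ 2 * (d ^ 2 / 4)) := by
    intro ω
    refine ENNReal.ofReal_le_ofReal ?_
    rw [input1, h, mul_pow, neg_sq, show d ^ 2 / 4 = (d / 2) ^ 2 by ring]
    have := abs_le.1 (abs_rmdr_le hd (obs1 P g ω n))
    exact mul_le_mul_of_nonneg_left (sq_le_sq' this.1 this.2) (sq_nonneg a)
  refine (lintegral_mono hle).trans ?_
  simp

lemma sigCost_le {a : ℝ} (ha : 3 ≤ a) :
    sigCost a ≤ ENNReal.ofReal (767 * (a ^ 2 * Real.log a)) := by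
  have ha0 : 0 < a := by linarith
  have hL : 1 ≤ Real.log a := by
    rw [Real.le_log_iff_exp_le ha0]
    linarith [Real.exp_one_lt_d9]
  have hLa : Real.log a ≤ a := by linarith [Real.log_le_sub_one_of_pos ha0]
  set L := Real.log a with hLdef
  -- The exponential weight `t` makes `exp (8 a t ^ 2)` equal to `a ^ 8`; with `d = 18 t` the tail
  -- factor is `a ^ (-9)`, which outweighs it together with `1 / t ^ 2 ≤ a`.
  set t := Real.sqrt (L / a) with ht
  have ht2 : t ^ 2 = L / a := Real.sq_sqrt (by positivity)
  have ht0 : 0 < t := Real.sqrt_pos.2 (by positivity)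
  have hd : 0 < 18 * t := by positivity
  have hg := isSignaling_signaling a (18 * t)
  refine (iInf₂_le (signaling a (18 * t)) ⟨18 * t, hd, hg⟩).trans (avgCost_le fun n => ?_)
  have hx := secondMoment_state_of_signaling_le (by linarith) hd ht0 hg n
  have hu := secondMoment_input1_of_signaling_le (P := params a) hd (fun y n => (hg y n).1) n
  simp only [stageCost, show (params a).q = 1 from rfl, show (params a).r2 = 0 from rfl,
    show (params a).r1 = a.toNNReal from rfl, ENNReal.coe_one, ENNReal.coe_zero, one_mul,
    zero_mul, add_zero]
  refine (add_le_add hx (mul_le_mul' (le_refl (ENNReal.ofReal a)) hu)).trans ?_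
  rw [← ENNReal.ofReal_mul ha0.le, ← ENNReal.ofReal_add (by positivity) (by positivity)]
  refine ENNReal.ofReal_le_ofReal ?_
  have hexp1 : Real.exp (8 * a * t ^ 2) = a ^ 8 := by
    rw [ht2, show 8 * a * (L / a) = (8 : ℕ) * L by field_simp; norm_num, Real.exp_nat_mul,
      hLdef, Real.exp_log ha0]
  have hexp2 : Real.exp (-(t * (a * (18 * t)) / 2)) = (a ^ 9)⁻¹ := by
    rw [show -(t * (a * (18 * t)) / 2) = -((9 : ℕ) * L) by
      rw [show t * (a * (18 * t)) = 18 * (a * t ^ 2) by ring, ht2]; field_simp; norm_num,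
      Real.exp_neg, Real.exp_nat_mul, hLdef, Real.exp_log ha0]
  have htail : 32 / t ^ 2 * (a ^ 9)⁻¹ * a ^ 8 ≤ 32 := by
    rw [ht2, show 32 / (L / a) * (a ^ 9)⁻¹ * a ^ 8 = 32 / L by field_simp]
    exact div_le_self (by norm_num) hL
  have ht1 : t ^ 2 ≤ 1 := by rw [ht2]; exact (div_le_one ha0).2 hLa
  rw [hexp1, hexp2]
  have hat : a * (a ^ 2 * ((18 * t) ^ 2 / 4)) = 81 * (a ^ 2 * L) := by
    rw [mul_pow, ht2]; field_simp; norm_num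
  rw [hat]
  have ha2 : 9 ≤ a ^ 2 := by nlinarith
  have h1 : 6 * a ^ 2 * (1 + (18 * t) ^ 2 / 4 + 32 / t ^ 2 * (a ^ 9)⁻¹ * a ^ 8)
      ≤ 6 * a ^ 2 * 114 := by
    gcongr
    nlinarith
  have h2 : a ^ 2 ≤ a ^ 2 * L := le_mul_of_one_le_right (by positivity) hL
  linarith

lemma le_sigCost (a : ℝ) : 4⁻¹ ≤ sigCost a := by
  refine le_iInf₂ fun g hg => ?_
  rw [← one_div]
  refine le_avgCost fun n => ?_
  have h := one_le_secondMoment_state (params a)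
    (fun n => (measurable_of_mem_signalingStrategies hg n).1)
    (fun n => (measurable_of_mem_signalingStrategies hg n).2) n
  refine h.trans (le_trans ?_ (le_trans le_self_add le_self_add))
  rw [stageCost, show (params a).q = 1 from rfl, ENNReal.coe_one, one_mul, add_assoc]
  exact le_self_add

end DecLQG

theorem proposition4 :
    (∀ᶠ a : ℝ in atTop,
      DecLQG.linCost a ≠ ∞ ∧ DecLQG.sigCost a ≠ 0 ∧ DecLQG.sigCost a ≠ ∞) ∧
    Tendsto (fun a : ℝ => DecLQG.linCost a / DecLQG.sigCost a) atTop (𝓝 ∞) ∧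
    (∃ c : ℝ, 0 < c ∧ ∀ᶠ a : ℝ in atTop,
      ENNReal.ofReal (c * a ^ 3) ≤ DecLQG.linCost a) ∧
    (∃ C : ℝ, 0 < C ∧ ∀ᶠ a : ℝ in atTop,
      DecLQG.sigCost a ≤ ENNReal.ofReal (C * (a ^ 2 * Real.log a))) := by
  refine ⟨?_, ?_, ⟨1 / 1600, by norm_num, ?_⟩, ⟨767, by norm_num, ?_⟩⟩
  · filter_upwards [eventually_ge_atTop 3] with a ha
    refine ⟨DecLQG.linCost_ne_top a, ?_, ?_⟩
    · exact ((ENNReal.inv_pos.2 (by norm_num)).trans_le (DecLQG.le_sigCost a)).ne'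
    · exact ne_top_of_le_ne_top ENNReal.ofReal_ne_top (DecLQG.sigCost_le ha)
  · have hlim : Tendsto (fun a : ℝ => ENNReal.ofReal (a / Real.log a / (1600 * 767)))
        atTop (𝓝 ∞) := by
      refine ENNReal.tendsto_ofReal_atTop.comp (Tendsto.atTop_div_const (by norm_num) ?_)
      have h0 : Tendsto (fun a : ℝ => Real.log a / a) atTop (𝓝[>] 0) := by
        refine tendsto_nhdsWithin_iff.2 ⟨Real.isLittleO_log_id_atTop.tendsto_div_nhds_zero, ?_⟩
        filter_upwards [eventually_gt_atTop 1] with a ha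
        exact div_pos (Real.log_pos ha) (by linarith)
      simpa only [Function.comp_def, inv_div] using tendsto_inv_nhdsGT_zero.comp h0
    refine tendsto_of_tendsto_of_tendsto_of_le_of_le' hlim tendsto_const_nhds ?_
      (Eventually.of_forall fun _ => le_top)
    filter_upwards [eventually_ge_atTop 3] with a ha
    have hlog : 0 < Real.log a := Real.log_pos (by linarith)
    calc ENNReal.ofReal (a / Real.log a / (1600 * 767))
        = ENNReal.ofReal (a ^ 3 / 1600) / ENNReal.ofReal (767 * (a ^ 2 * Real.log a)) := by
          rw [← ENNReal.ofReal_div_of_pos (by positivity)]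
          congr 1
          field_simp
      _ ≤ _ := ENNReal.div_le_div (DecLQG.le_linCost (by linarith)) (DecLQG.sigCost_le ha)
  · filter_upwards [eventually_ge_atTop 1] with a ha
    rw [one_div_mul_eq_div]
    exact DecLQG.le_linCost ha
  · filter_upwards [eventually_ge_atTop 3] with a ha
    exact DecLQG.sigCost_le ha
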